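/- Setup. Let $\Gamma$ be a totally ordered abelian group and $F$ a field with a valuation $\nu:F^\times\to\Gamma$ (with $\nu(0)=+\infty$), ring of integers $\mathcal O_F$ and residue map $\mathcal O_F\to\overline F$, $x\mapsto\overline x$. Assume that $\nu$ is split by a homomorphism $t:\Gamma\to F^\times$, $\nu\circ t=\mathrm{id}_\Gamma$, and that the residue field $\overline F$ is a local field (a non-discrete locally compact field, its topology being given by a nontrivial absolute value). Fix a Haar measure on $(\overline F,+)$, and equip $\overline F^n$ with the product measure. Let $\mathbb C(\Gamma)$ be the field of fractions of the complex group algebra of $\Gamma$, the basis elements being written $X^\gamma$. For $g:\overline F^n\to\mathbb C$, $a\in F^n$, $\gamma\in\Gamma^n$, the lift $g^{a,\gamma}:F^n\to\mathbb C$ takes the value $g\big(\overline{(x_1-a_1)t(-\gamma_1)},\dots,\overline{(x_n-a_n)t(-\gamma_n)}\big)$ at $x$ if $x_i\in a_i+t(\gamma_i)\mathcal O_F$ for all $i$, and $0$ otherwise. A function $F\to\mathbb C(\Gamma)$ is *simple* if it is of the form $g^{a,\gamma}X^\delta$ with $g:\overline F\to\mathbb C$ Haar integrable, $a\in F$, $\gamma,\delta\in\Gamma$;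 the *integrable* functions on $F$ are the elements of the $\mathbb C(\Gamma)$-span of the simple functions, and $\int^F$ is the unique $\mathbb C(\Gamma)$-linear functional on them with $\int^F g^{a,\gamma}(x)\,dx=\big(\int_{\overline F} g(u)\,du\big)X^\gamma$. A function $f:F^n\to\mathbb C(\Gamma)$ is *Fubini* if: for $n=1$, it is integrable, and then its repeated integral is $\int^F f(x)\,dx$; for $n>1$, for each $r$ every section $x_r\mapsto f(x_1,\dots,x_n)$ is integrable, the function $(x_i)_{i\ne r}\mapsto\int^F f(x_1,\dots,x_n)\,dx_r$ is Fubini on $F^{n-1}$, and the repeated integral of the latter function does not depend on $r$; this common value is the repeated integral $\int^{F^n}f(x)\,dx$. A Fubini function $f$ is *strongly Fubini* if: for $n=1$, it is simple; for $n>1$, for each $r$ every section $x_r\mapsto f(x_1,\dots,x_n)$ is simple and $(x_i)_{i\ne r}\mapsto\int^F f(x_1,\dots,x_n)\,dx_r$ is strongly Fubini on $F^{n-1}$. A function $g:\overline F^n\to\mathbb C$ is *Fubini* if it is Haar integrable and (when $n>1$) for each $r$ every section $u_r\mapsto g(u_1,\dots,u_n)$ is Haar integrable and $(u_i)_{i\ne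 r}\mapsto\int g(u_1,\dots,u_n)\,du_r$ is Fubini on $\overline F^{n-1}$. It is *GL-Fubini* if $g\circ\tau$ is Fubini for every $\tau\in\mathrm{GL}_n(\overline F)$. Proposition. Let $n\ge1$, let $g$ be a GL-Fubini function on $\overline F^n$, let $a\in F^n$, $\gamma\in\Gamma^n$, $\delta\in\Gamma$, and put $f=g^{a,\gamma}X^\delta$. Let $U\in\mathrm{GL}_n(F)$ be unipotent upper triangular. Then $f\circ U:x\mapsto f(Ux)$ is strongly Fubini on $F^n$, and $$\int^{F^n}f(Ux)\,dx=\int^{F^n}f(x)\,dx.$$ -/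

import Mathlib

open MeasureTheory

noncomputable section

namespace FubiniLift

/-- The standing data: a field `F` with a valuation `v` whose value group is the totally ordered
group `Γ` (written additively, with `v 0 = ⊤`), a field `k` identified with the residue field of
`v` through the residue map from the ring of integers, and a splitting `t : Γ → Fˣ` of `v`. -/
structure SplitValuation (Γ F k : Type*) [AddCommGroup Γ] [LinearOrder Γ] [IsOrderedAddMonoid Γ]
    [Field F] [Field k] where
  /-- the valuation -/
  v : AddValuation F (WithTop Γ)
  /-- the residue map, defined on the ring of integers -/
  residue : (AddValuation.toValuation v).integer →+* k
  residue_surjective : Function.Surjective residue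
  /-- the kernel of the residue map is the maximal ideal of the ring of integers -/
  residue_eq_zero_iff : ∀ x : (AddValuation.toValuation v).integer,
    residue x = 0 ↔ 0 < v (x : F)
  /-- the splitting homomorphism -/
  t : Multiplicative Γ →* Fˣ
  v_t : ∀ γ : Γ, v ((t (Multiplicative.ofAdd γ) : Fˣ) : F) = (γ : WithTop Γ)

/-- `ℂ(Γ)`: the field of fractions of the complex group algebra of `Γ`. -/
abbrev CGamma (Γ : Type*) [AddCommGroup Γ] [LinearOrder Γ] [IsOrderedAddMonoid Γ] : Type _ :=
  FractionRing (AddMonoidAlgebra ℂ Γ)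

/-- The basis element `X ^ γ` of the group algebra, as an element of `ℂ(Γ)`. -/
def X {Γ : Type*} [AddCommGroup Γ] [LinearOrder Γ] [IsOrderedAddMonoid Γ] (γ : Γ) : CGamma Γ :=
  algebraMap (AddMonoidAlgebra ℂ Γ) (CGamma Γ) (AddMonoidAlgebra.single γ 1)

/-- A complex number, as an element of `ℂ(Γ)`. -/
def const (Γ : Type*) [AddCommGroup Γ] [LinearOrder Γ] [IsOrderedAddMonoid Γ] (z : ℂ) :
    CGamma Γ :=
  algebraMap (AddMonoidAlgebra ℂ Γ) (CGamma Γ) (AddMonoidAlgebra.single 0 z)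

section

variable {Γ F k : Type*} [AddCommGroup Γ] [LinearOrder Γ] [IsOrderedAddMonoid Γ] [Field F]
  [Field k] (S : SplitValuation Γ F k)

namespace SplitValuation

/-- The ring of integers of `F`. -/
abbrev integers : Subring F := (AddValuation.toValuation S.v).integer

theorem mem_integers_iff (x : F) : x ∈ S.integers ↔ 0 ≤ S.v x := Iff.rfl

/-- The element `t(γ)` of `F`. -/
def tt (γ : Γ) : F := ((S.t (Multiplicative.ofAdd γ) : Fˣ) : F)

open Classical in
/-- The lift `g^{a,γ}` to `F` of a function `g` on the residue field. Note that `x` lies in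
`a + t(γ) O_F` if and only if `(x - a) t(-γ)` lies in `O_F`. -/
def lift {A : Type*} [AddCommGroup A] (g : k → A) (a : F) (γ : Γ) (x : F) : A :=
  if h : (x - a) * S.tt (-γ) ∈ S.integers then g (S.residue ⟨_, h⟩) else 0

open Classical in
/-- The lift `g^{a,γ}` to `F^n` of a function `g` on `k^n`. -/
def liftPi {A : Type*} [AddCommGroup A] {n : ℕ} (g : (Fin n → k) → A) (a : Fin n → F)
    (γ : Fin n → Γ) (x : Fin n → F) : A :=
  if h : ∀ i, (x i - a i) * S.tt (-γ i) ∈ S.integers then g (fun i => S.residue ⟨_, h i⟩) else 0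

theorem v_tt (γ : Γ) : S.v (S.tt γ) = (γ : WithTop Γ) := S.v_t γ

theorem tt_add (γ δ : Γ) : S.tt (γ + δ) = S.tt γ * S.tt δ := by
  simp [tt, ofAdd_add]

theorem tt_zero : S.tt 0 = 1 := by simp [tt]

theorem lift_of_mem {A : Type*} [AddCommGroup A] (g : k → A) (a : F) (γ : Γ) (x : F)
    (h : (x - a) * S.tt (-γ) ∈ S.integers) : S.lift g a γ x = g (S.residue ⟨_, h⟩) := by
  rw [lift, dif_pos h]

theorem lift_of_notMem {A : Type*} [AddCommGroup A] (g : k → A) (a : F) (γ : Γ) (x : F)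
    (h : (x - a) * S.tt (-γ) ∉ S.integers) : S.lift g a γ x = 0 := by
  rw [lift, dif_neg h]

/-- A lift at the same radius, seen from another point of its ball. -/
theorem lift_same {A : Type*} [AddCommGroup A] (g : k → A) (a b x : F) (γ : Γ)
    (hb : (b - a) * S.tt (-γ) ∈ S.integers) :
    S.lift g a γ x = S.lift (fun u => g (u + S.residue ⟨_, hb⟩)) b γ x := by
  have e : (x - a) * S.tt (-γ) = (x - b) * S.tt (-γ) + (b - a) * S.tt (-γ) := by ring
  by_cases h : (x - b) * S.tt (-γ) ∈ S.integers
  · have h' : (x - a) * S.tt (-γ) ∈ S.integers := e ▸ S.integers.add_mem h hb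
    rw [lift_of_mem _ _ _ _ _ h, lift_of_mem _ _ _ _ _ h', ← map_add]
    congr 2
    exact Subtype.ext e
  · have h' : (x - a) * S.tt (-γ) ∉ S.integers := fun h' => h (by
      have := S.integers.sub_mem h' hb
      rwa [e, add_sub_cancel_right] at this)
    rw [lift_of_notMem _ _ _ _ _ h, lift_of_notMem _ _ _ _ _ h']

/-- A lift is constant on each ball of strictly smaller size. -/
theorem lift_const {A : Type*} [AddCommGroup A] (g : k → A) (a b x : F) (γ δ : Γ) (hγ : γ < δ)
    (hx : (x - b) * S.tt (-δ) ∈ S.integers) : S.lift g a γ x = S.lift g a γ b := by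
  have hpos : 0 < S.v ((x - b) * S.tt (-γ)) := by
    have e : (x - b) * S.tt (-γ) = (x - b) * S.tt (-δ) * S.tt (δ - γ) := by
      rw [mul_assoc, ← tt_add]; congr 2; abel
    rw [e, AddValuation.map_mul, v_tt]
    have h2 : (0 : WithTop Γ) < ((δ - γ : Γ) : WithTop Γ) := by
      exact_mod_cast sub_pos.2 hγ
    exact h2.trans_le (le_add_of_nonneg_left ((S.mem_integers_iff _).1 hx))
  have hm : (x - b) * S.tt (-γ) ∈ S.integers := (S.mem_integers_iff _).2 hpos.le
  have e : (x - a) * S.tt (-γ) = (x - b) * S.tt (-γ) + (b - a) * S.tt (-γ) := by ring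
  have hz : S.residue ⟨_, hm⟩ = 0 := (S.residue_eq_zero_iff _).2 hpos
  by_cases h : (b - a) * S.tt (-γ) ∈ S.integers
  · have h' : (x - a) * S.tt (-γ) ∈ S.integers := e ▸ S.integers.add_mem hm h
    rw [lift_of_mem _ _ _ _ _ h, lift_of_mem _ _ _ _ _ h']
    have : (⟨_, h'⟩ : S.integers) = ⟨_, hm⟩ + ⟨_, h⟩ := Subtype.ext e
    rw [this, map_add, hz, zero_add]
  · have h' : (x - a) * S.tt (-γ) ∉ S.integers := fun h' => h (by
      have := S.integers.sub_mem h' hm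
      rwa [e, add_sub_cancel_left] at this)
    rw [lift_of_notMem _ _ _ _ _ h, lift_of_notMem _ _ _ _ _ h']

end SplitValuation

end

section

variable {Γ F k : Type*} [AddCommGroup Γ] [LinearOrder Γ] [IsOrderedAddMonoid Γ] [Field F]
  [Field k] [MeasurableSpace k] (S : SplitValuation Γ F k) (μ : Measure k)

namespace SplitValuation

/-- The simple functions on `F`: those of the form `g^{a,γ} X^δ` with `g` Haar integrable. -/
def IsSimple (f : F → CGamma Γ) : Prop :=
  ∃ g : k → ℂ, Integrable g μ ∧ ∃ (a : F) (γ δ : Γ),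
    f = fun x => const Γ (S.lift g a γ x) * X δ

/-- The integrable functions on `F`: the `ℂ(Γ)`-span of the simple functions. -/
def integrableFunctions : Submodule (CGamma Γ) (F → CGamma Γ) :=
  Submodule.span (CGamma Γ) {f | S.IsSimple μ f}

/-- The graph of the integral on `F`: the `ℂ(Γ)`-span of all pairs `(g^{a,γ}, (∫ g) X^γ)` with `g`
Haar integrable. These pairs lie in the graph of any `ℂ(Γ)`-linear functional that lifts the Haar
integral, is translation invariant and satisfies `∫ f(αx) dx = |α|⁻¹ ∫ f(x) dx`, and they determine
it. That the span is indeed the graph of a function is proved below (`integralGraph_zero`). -/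
def integralGraph : Submodule (CGamma Γ) ((F → CGamma Γ) × CGamma Γ) :=
  Submodule.span (CGamma Γ) {p | ∃ g : k → ℂ, Integrable g μ ∧ ∃ (a : F) (γ : Γ),
    p = (fun x => const Γ (S.lift g a γ x), const Γ (∫ u, g u ∂μ) * X γ)}

open Classical in
/-- The `ℂ(Γ)`-valued integral of a function on `F` (with the value `0` if it is not
integrable). -/
def integral (f : F → CGamma Γ) : CGamma Γ :=
  if h : ∃ c, (f, c) ∈ S.integralGraph μ then h.choose else 0

end SplitValuation

end

section

variable {Γ F k : Type*} [AddCommGroup Γ] [LinearOrder Γ] [IsOrderedAddMonoid Γ] [Field F]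
  [NontriviallyNormedField k] [LocallyCompactSpace k] [MeasurableSpace k] [BorelSpace k]
  (S : SplitValuation Γ F k) (μ : Measure k) [μ.IsAddHaarMeasure]

theorem mul_const (c : CGamma Γ) (z : ℂ) : c * const Γ z = z • c := by
  have h : const Γ z = algebraMap ℂ (CGamma Γ) z := by
    rw [IsScalarTower.algebraMap_apply ℂ (AddMonoidAlgebra ℂ Γ) (CGamma Γ)]
    rfl
  rw [h, Algebra.smul_def, mul_comm]

theorem sum_integral_eq_zero {ι : Type*} (s : Finset ι) (c : ι → CGamma Γ) (g : ι → k → ℂ)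
    (hg : ∀ i ∈ s, Integrable (g i) μ) (K : CGamma Γ)
    (h : ∀ u, ∑ i ∈ s, c i * const Γ (g i u) = K) :
    K = 0 ∧ ∑ i ∈ s, c i * const Γ (∫ u, g i u ∂μ) = 0 := by
  have hnc : NoncompactSpace k := inferInstance
  have key : ∀ φ : Module.Dual ℂ (CGamma Γ),
      φ K = 0 ∧ φ (∑ i ∈ s, c i * const Γ (∫ u, g i u ∂μ)) = 0 := by
    intro φ
    have h1 : ∀ u, ∑ i ∈ s, g i u * φ (c i) = φ K := by
      intro u
      rw [← h u, map_sum]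
      exact Finset.sum_congr rfl fun i _ => by rw [mul_const, map_smul, smul_eq_mul]
    have h2 : Integrable (fun _ : k => φ K) μ := by
      rw [show (fun _ : k => φ K) = fun u => ∑ i ∈ s, g i u * φ (c i) from
        funext fun u => (h1 u).symm]
      exact integrable_finsetSum s fun i hi => (hg i hi).mul_const _
    have h3 : φ K = 0 := by
      rcases integrable_const_iff.1 h2 with h0 | h0
      · exact h0
      · have := h0.measure_univ_lt_top
        simp [measure_univ_of_isAddLeftInvariant] at this
    refine ⟨h3, ?_⟩
    have h4 : ∫ u, ∑ i ∈ s, g i u * φ (c i) ∂μ = 0 := by simp [h1, h3]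
    rw [integral_finsetSum s fun i hi => (hg i hi).mul_const _] at h4
    rw [map_sum, ← h4]
    refine Finset.sum_congr rfl fun i _ => ?_
    rw [mul_const, map_smul, smul_eq_mul, integral_mul_const]
  exact ⟨(Module.forall_dual_apply_eq_zero_iff ℂ _).1 fun φ => (key φ).1,
    (Module.forall_dual_apply_eq_zero_iff ℂ _).1 fun φ => (key φ).2⟩

namespace SplitValuation

/-- A vanishing combination of lifts has vanishing integral. -/
theorem sum_lift_integral_eq_zero {ι : Type*} (c : ι → CGamma Γ) (g : ι → k → ℂ) (a : ι → F)
    (γ : ι → Γ) (s : Finset ι) (hg : ∀ i ∈ s, Integrable (g i) μ)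
    (h : ∀ x, ∑ i ∈ s, c i * const Γ (S.lift (g i) (a i) (γ i) x) = 0) :
    ∑ i ∈ s, c i * (const Γ (∫ u, g i u ∂μ) * X (γ i)) = 0 := by
  classical
  induction s using Finset.strongInduction with
  | H s ih =>
  rcases s.eq_empty_or_nonempty with rfl | hs
  · simp
  obtain ⟨j, hj, hmax⟩ := s.exists_max_image γ hs
  let p : ι → Prop := fun i => γ i = γ j ∧ (a j - a i) * S.tt (-γ j) ∈ S.integers
  have hpj : p j := ⟨rfl, by simp⟩
  -- lifts which live on the ball of `j`
  have hp : ∀ i, p i → ∃ d : k, ∀ x, S.lift (g i) (a i) (γ i) x =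
      S.lift (fun u => g i (u + d)) (a j) (γ j) x := by
    rintro i ⟨h1, h2⟩
    exact ⟨_, fun x => by rw [h1]; exact S.lift_same (g i) (a i) (a j) x (γ j) h2⟩
  choose! d hd using hp
  -- the others are constant on that ball
  have hnp : ∀ i ∈ s, ¬ p i → ∀ x, (x - a j) * S.tt (-γ j) ∈ S.integers →
      S.lift (g i) (a i) (γ i) x = S.lift (g i) (a i) (γ i) (a j) := by
    intro i hi hpi x hx
    rcases (hmax i hi).lt_or_eq with hlt | heq
    · exact S.lift_const _ _ _ _ _ _ hlt hx
    · have h2 : (a j - a i) * S.tt (-γ j) ∉ S.integers := fun h2 => hpi ⟨heq, h2⟩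
      have h3 : (x - a i) * S.tt (-γ j) ∉ S.integers := fun h3 => h2 (by
        have := S.integers.sub_mem h3 hx
        rwa [← sub_mul, sub_sub_sub_cancel_left] at this)
      rw [heq, lift_of_notMem _ _ _ _ _ h2, lift_of_notMem _ _ _ _ _ h3]
  have hsplit := fun x => (Finset.sum_filter_add_sum_filter_not s p
    fun i => c i * const Γ (S.lift (g i) (a i) (γ i) x)).trans (h x)
  set K : CGamma Γ :=
    - ∑ i ∈ s with ¬ p i, c i * const Γ (S.lift (g i) (a i) (γ i) (a j)) with hK
  have hball : ∀ x, (x - a j) * S.tt (-γ j) ∈ S.integers →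
      ∑ i ∈ s with p i, c i * const Γ (S.lift (g i) (a i) (γ i) x) = K := by
    intro x hx
    rw [eq_neg_of_add_eq_zero_left (hsplit x), hK]
    congr 1
    refine Finset.sum_congr rfl fun i hi => ?_
    rw [Finset.mem_filter] at hi
    rw [hnp i hi.1 hi.2 x hx]
  have hres : ∀ u, ∑ i ∈ s with p i, c i * const Γ (g i (u + d i)) = K := by
    intro u
    obtain ⟨y, rfl⟩ := S.residue_surjective u
    have e : ((a j + S.tt (γ j) * (y : F)) - a j) * S.tt (-γ j) = y := by
      have h1 : S.tt (γ j) * S.tt (-γ j) = 1 := by rw [← tt_add, add_neg_cancel, tt_zero]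
      calc _ = (S.tt (γ j) * S.tt (-γ j)) * (y : F) := by ring
        _ = y := by rw [h1, one_mul]
    have hm : ((a j + S.tt (γ j) * (y : F)) - a j) * S.tt (-γ j) ∈ S.integers := by
      rw [e]; exact y.2
    rw [← hball _ hm]
    refine Finset.sum_congr rfl fun i hi => ?_
    rw [hd i (Finset.mem_filter.1 hi).2, lift_of_mem _ _ _ _ _ hm]
    congr 4
    exact congrArg S.residue (Subtype.ext e.symm)
  obtain ⟨hK0, hint⟩ := sum_integral_eq_zero μ (s.filter p) c (fun i u => g i (u + d i))
    (fun i hi => (hg i (Finset.mem_filter.1 hi).1).comp_add_right (d i)) K hres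
  have hT : ∀ x, ∑ i ∈ s with p i, c i * const Γ (S.lift (g i) (a i) (γ i) x) = 0 := by
    intro x
    by_cases hx : (x - a j) * S.tt (-γ j) ∈ S.integers
    · rw [hball x hx, hK0]
    · refine Finset.sum_eq_zero fun i hi => ?_
      rw [hd i (Finset.mem_filter.1 hi).2, lift_of_notMem _ _ _ _ _ hx]
      simp [const]
  have hrest := ih (s.filter fun i => ¬ p i)
    (Finset.filter_ssubset.2 ⟨j, hj, not_not.2 hpj⟩)
    (fun i hi => hg i (Finset.mem_filter.1 hi).1)
    (fun x => by have := hsplit x; rwa [hT x, zero_add] at this)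
  rw [← Finset.sum_filter_add_sum_filter_not s p, hrest, add_zero]
  have : ∑ i ∈ s with p i, c i * (const Γ (∫ u, g i u ∂μ) * X (γ i)) =
      (∑ i ∈ s with p i, c i * const Γ (∫ u, g i (u + d i) ∂μ)) * X (γ j) := by
    rw [Finset.sum_mul]
    refine Finset.sum_congr rfl fun i hi => ?_
    rw [integral_add_right_eq_self (fun u => g i u), (Finset.mem_filter.1 hi).2.1, mul_assoc]
  rw [this, hint, zero_mul]

/-- The integral is single-valued. -/
theorem integralGraph_zero {c : CGamma Γ} (h : ((0 : F → CGamma Γ), c) ∈ S.integralGraph μ) :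
    c = 0 := by
  obtain ⟨m, b, p, hp⟩ := Submodule.mem_span_set'.1 h
  choose g hg a γ he using fun i => (p i).2
  have hp1 := congrArg Prod.fst hp
  have hp2 := congrArg Prod.snd hp
  simp only [he, Prod.fst_sum, Prod.snd_sum, Prod.smul_fst, Prod.smul_snd, smul_eq_mul] at hp1 hp2
  rw [← hp2]
  refine S.sum_lift_integral_eq_zero μ b g a γ Finset.univ (fun i _ => hg i) fun x => ?_
  simpa [Finset.sum_apply] using congrFun hp1 x

theorem integral_eq_of_mem {f : F → CGamma Γ} {c : CGamma Γ} (h : (f, c) ∈ S.integralGraph μ) :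
    S.integral μ f = c := by
  have hex : ∃ c, (f, c) ∈ S.integralGraph μ := ⟨c, h⟩
  rw [integral, dif_pos hex]
  have := (S.integralGraph μ).sub_mem hex.choose_spec h
  rw [Prod.mk_sub_mk, sub_self] at this
  exact sub_eq_zero.1 (S.integralGraph_zero μ this)

/-- The integral is defined on all integrable functions. -/
theorem mem_integralGraph {f : F → CGamma Γ} (hf : f ∈ S.integrableFunctions μ) :
    (f, S.integral μ f) ∈ S.integralGraph μ := by
  suffices h : ∃ c, (f, c) ∈ S.integralGraph μ by
    obtain ⟨c, hc⟩ := h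
    rwa [S.integral_eq_of_mem μ hc]
  induction hf using Submodule.span_induction with
  | mem f hf =>
    obtain ⟨g, hg, a, γ, δ, rfl⟩ := hf
    refine ⟨X δ * (const Γ (∫ u, g u ∂μ) * X γ), ?_⟩
    have := (S.integralGraph μ).smul_mem (X δ) (Submodule.subset_span ⟨g, hg, a, γ, rfl⟩)
    convert this using 2
    · funext x
      simp [mul_comm]
    · rfl
  | zero => exact ⟨0, (S.integralGraph μ).zero_mem⟩
  | add f f' _ _ h h' =>
    obtain ⟨c, hc⟩ := h
    obtain ⟨c', hc'⟩ := h'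
    exact ⟨c + c', (S.integralGraph μ).add_mem hc hc'⟩
  | smul b f _ h =>
    obtain ⟨c, hc⟩ := h
    exact ⟨b • c, (S.integralGraph μ).smul_mem b hc⟩

/-- The integral of the lift of a Haar integrable function. -/
theorem integral_lift {g : k → ℂ} (hg : Integrable g μ) (a : F) (γ : Γ) :
    S.integral μ (fun x => const Γ (S.lift g a γ x)) = const Γ (∫ u, g u ∂μ) * X γ :=
  S.integral_eq_of_mem μ (Submodule.subset_span ⟨g, hg, a, γ, rfl⟩)

end SplitValuation

end

section

variable {Γ F k : Type*} [AddCommGroup Γ] [LinearOrder Γ] [IsOrderedAddMonoid Γ] [Field F]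
  [Field k] [MeasurableSpace k] (S : SplitValuation Γ F k) (μ : Measure k)

namespace SplitValuation

/-- The function on `F^n` obtained from `f` on `F^(n+1)` by integrating out the variable of
index `r`. -/
def partialIntegral {n : ℕ} (r : Fin (n + 1)) (f : (Fin (n + 1) → F) → CGamma Γ)
    (x : Fin n → F) : CGamma Γ :=
  S.integral μ fun y => f (r.insertNth (α := fun _ => F) y x)

/-- The repeated integral of a function on `F^n`. For a Fubini function the order in which the
variables are integrated out is immaterial. The recursion starts at the one-point space `F^0`,
where the integral is evaluation, so that it is the integral on `F` for `n = 1`. -/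
def repeatedIntegral : (n : ℕ) → ((Fin n → F) → CGamma Γ) → CGamma Γ
  | 0, f => f Fin.elim0
  | n + 1, f => repeatedIntegral n (S.partialIntegral μ 0 f)

/-- Fubini functions on `F^n`. The recursion starts at the one-point space `F^0`, where there is
no condition; for `n = 1` it says that `f` is integrable on `F`. -/
def IsFubini : (n : ℕ) → ((Fin n → F) → CGamma Γ) → Prop
  | 0, _ => True
  | n + 1, f =>
    (∀ r : Fin (n + 1),
      (∀ x : Fin n → F,
        (fun y => f (r.insertNth (α := fun _ => F) y x)) ∈ S.integrableFunctions μ) ∧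
      IsFubini n (S.partialIntegral μ r f)) ∧
    ∀ r s : Fin (n + 1),
      S.repeatedIntegral μ n (S.partialIntegral μ r f) =
        S.repeatedIntegral μ n (S.partialIntegral μ s f)

/-- Strongly Fubini functions on `F^n`. For `n = 1` these are the simple functions. -/
def IsStronglyFubini : (n : ℕ) → ((Fin n → F) → CGamma Γ) → Prop
  | 0, _ => True
  | n + 1, f =>
    S.IsFubini μ (n + 1) f ∧
    ∀ r : Fin (n + 1),
      (∀ x : Fin n → F, S.IsSimple μ fun y => f (r.insertNth (α := fun _ => F) y x)) ∧
      IsStronglyFubini n (S.partialIntegral μ r f)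

end SplitValuation

end

section

variable {k : Type*} [MeasurableSpace k] (μ : Measure k)

/-- Fubini functions on `k^n`: Haar integrable with respect to the product measure, and such that
all sections in one variable are integrable and all the functions obtained by integrating out one
variable are again Fubini. (That the repeated integral does not depend on the order is then
automatic, all of them being equal to the Haar integral.) -/
def IsResidueFubini : (n : ℕ) → ((Fin n → k) → ℂ) → Prop
  | 0, _ => True
  | n + 1, g =>
    Integrable g (Measure.pi fun _ : Fin (n + 1) => μ) ∧
    ∀ r : Fin (n + 1),
      (∀ u : Fin n → k, Integrable (fun w => g (r.insertNth (α := fun _ => k) w u)) μ) ∧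
      IsResidueFubini n fun u => ∫ w, g (r.insertNth (α := fun _ => k) w u) ∂μ

/-- GL-Fubini functions on `k^n`: all `g ∘ τ` with `τ ∈ GL_n(k)` are Fubini. -/
def IsGLFubini [Field k] {n : ℕ} (g : (Fin n → k) → ℂ) : Prop :=
  ∀ τ : Matrix.GeneralLinearGroup (Fin n) k,
    IsResidueFubini μ n fun u => g ((τ : Matrix (Fin n) (Fin n) k).mulVec u)

end

/-- Unipotent upper triangular matrices. -/
def IsUnipotentUpperTriangular {R : Type*} [Zero R] [One R] {n : ℕ}
    (U : Matrix (Fin n) (Fin n) R) : Prop :=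
  (∀ i j, j < i → U i j = 0) ∧ ∀ i, U i i = 1

end FubiniLift

end

/-! The composite `f ∘ U` is, up to the factor `X δ`, the pullback of `g` along the reduction of an
affine map `x ↦ A x + b`, where `A = D U` and the diagonal matrix `D` carries the radii. The proof
treats every invertible `A`, because this class is stable under integrating out any one variable. In
column `r` take an entry `A i r` of least valuation `ρ`. Dividing the column by `t(ρ)` gives an
integral direction with unit `i`-th entry, so the section in `x_r` is a lift of `g` along a line in
`k^n` (`pullback_line`). Its integral is `X (-ρ)` times a pullback of the corresponding line
integral of `g`, now along an affine map whose linear part is the Schur complement of the pivot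
(`partialIntegral_affinePullback`). Line integrals of GL-Fubini functions are again GL-Fubini
(`IsGLFubini.lineIntegral`), so induction applies.

Pivots and Schur complements multiply to the determinant up to sign, so the repeated integral
depends on `A` only through the valuation and leading residue of `det A`
(`affinePullback_stronglyFubini`). Hence the order of integration is immaterial. Since `det U = 1`,
the matrices `U` and `1` give the same value. -/

open scoped Pointwise

noncomputable section

namespace FubiniLift

/-! ### Scaling of Haar integrals on the residue field. -/

section Modulus

variable {k : Type*} [NontriviallyNormedField k] [LocallyCompactSpace k]

/-- The factor by which an integral over `k` changes under the substitution `w ↦ z w`. -/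
def invModulus (z : kˣ) : ℂ :=
  letI : MeasurableSpace k := borel k
  haveI : BorelSpace k := ⟨rfl⟩
  ((distribHaarChar k z⁻¹ : ℝ) : ℂ)

theorem invModulus_one : invModulus (1 : kˣ) = 1 := by simp [invModulus]

theorem invModulus_mul (z w : kˣ) : invModulus (z * w) = invModulus z * invModulus w := by
  simp [invModulus, mul_comm]

/-- The modulus takes nonnegative real values and its value at `-1` squares to `1`. This disposes of
the cofactor signs in the determinant expansion. -/
theorem invModulus_neg_one_pow (m : ℕ) : invModulus ((-1 : kˣ) ^ m) = 1 := by
  borelize k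
  have h : distribHaarChar k (-1 : kˣ) = 1 := by
    have h2 : distribHaarChar k (-1 : kˣ) ^ 2 = 1 := by rw [← map_pow]; simp
    exact (pow_eq_one_iff_of_nonneg (zero_le (a := _)) two_ne_zero).1 h2
  have h' : distribHaarChar k (((-1 : kˣ) ^ m)⁻¹) = 1 := by rw [map_inv, map_pow, h]; simp
  simp [invModulus, h']

variable [MeasurableSpace k] [BorelSpace k] (μ : Measure k) [μ.IsAddHaarMeasure]

theorem integral_mul_left_eq_invModulus (z : kˣ) (φ : k → ℂ) :
    ∫ w, φ (z * w) ∂μ = invModulus z * ∫ w, φ w ∂μ := by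
  -- `invModulus` is built on `borel k`, so the given σ-algebra is replaced by that one.
  borelize k
  have : ProperSpace k := .of_nontriviallyNormedField_of_weaklyLocallyCompactSpace k
  let e : k ≃ᵐ k := (Homeomorph.smul z).toMeasurableEquiv
  have he : μ.map e = (distribHaarChar k z⁻¹) • μ := by
    ext s hs
    rw [e.map_apply]
    have : e ⁻¹' s = z⁻¹ • s := by
      ext x; simp [e, Set.mem_smul_set_iff_inv_smul_mem]
    rw [this, ← distribHaarChar_mul]
    rfl
  calc ∫ w, φ (z * w) ∂μ = ∫ w, φ (e w) ∂μ := rfl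
    _ = ∫ w, φ w ∂(μ.map e) := (integral_map_equiv e φ).symm
    _ = invModulus z * ∫ w, φ w ∂μ := by
      rw [he, integral_smul_nnreal_measure]
      simp [invModulus, NNReal.smul_def]

end Modulus

/-! ### Line integrals of GL-Fubini functions over the residue field. -/

section Residue

variable {k : Type*} [NontriviallyNormedField k]

/-- The function obtained from `g` by integrating along the direction `e`, on the coordinate
hyperplane of the coordinate `i`. -/
def lineIntegral [MeasurableSpace k] (μ : Measure k) {n : ℕ} (g : (Fin (n + 1) → k) → ℂ)
    (i : Fin (n + 1)) (e : Fin (n + 1) → k) (u : Fin n → k) : ℂ :=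
  ∫ w, g (i.insertNth (α := fun _ => k) 0 u + w • e) ∂μ

/-- An invertible matrix with a prescribed column and a prescribed complementary block. -/
theorem exists_GL_insertNth {n : ℕ} (i : Fin (n + 1)) (e : Fin (n + 1) → k)
    (he : e i ≠ 0) (τ : Matrix.GeneralLinearGroup (Fin n) k) :
    ∃ T : Matrix.GeneralLinearGroup (Fin (n + 1)) k, ∀ (w : k) (u : Fin n → k),
      (T : Matrix _ _ k).mulVec (i.insertNth (α := fun _ => k) w u) =
        i.insertNth (α := fun _ => k) 0 ((τ : Matrix _ _ k).mulVec u) + w • e := by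
  let M : Matrix (Fin (n + 1)) (Fin (n + 1)) k := fun a =>
    i.insertNth (α := fun _ => k) (e a)
      (i.insertNth (α := fun _ => Fin n → k) 0 (fun a' => (τ : Matrix _ _ k) a') a)
  have hdet : M.det ≠ 0 := by
    -- Row `i` of `M` vanishes off column `i`, so the expansion leaves only `± e i * det τ`.
    rw [Matrix.det_succ_row M i, Fin.sum_univ_succAbove _ i]
    have h1 : M.submatrix i.succAbove i.succAbove = (τ : Matrix (Fin n) (Fin n) k) := by
      ext a b; rw [Matrix.submatrix_apply]; simp [M]
    have h2 : (τ : Matrix (Fin n) (Fin n) k).det ≠ 0 :=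
      ((Matrix.isUnit_iff_isUnit_det _).1 τ.isUnit).ne_zero
    rw [h1]
    simp [M, he, h2]
  refine ⟨Matrix.GeneralLinearGroup.mkOfDetNeZero M hdet, fun w u => ?_⟩
  have hM : ((Matrix.GeneralLinearGroup.mkOfDetNeZero M hdet :
    Matrix.GeneralLinearGroup (Fin (n + 1)) k) : Matrix _ _ k) = M := rfl
  rw [hM]
  ext a
  rw [Matrix.mulVec, dotProduct, Fin.sum_univ_succAbove _ i]
  rcases Fin.eq_self_or_eq_succAbove i a with rfl | ⟨a, rfl⟩
  · simp [M, mul_comm]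
  · simp [M, Matrix.mulVec, dotProduct]; ring

variable [MeasurableSpace k] (μ : Measure k)

theorem IsGLFubini.isResidueFubini {n : ℕ} {g : (Fin n → k) → ℂ} (hg : IsGLFubini μ g) :
    IsResidueFubini μ n g := by
  simpa using hg 1

theorem IsGLFubini.integrable_line {n : ℕ} {g : (Fin (n + 1) → k) → ℂ} (hg : IsGLFubini μ g)
    {i : Fin (n + 1)} {e : Fin (n + 1) → k} (he : e i ≠ 0) (u : Fin n → k) :
    Integrable (fun w => g (i.insertNth (α := fun _ => k) 0 u + w • e)) μ := by
  obtain ⟨T, hT⟩ := exists_GL_insertNth i e he 1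
  simpa [hT] using ((hg T).2 i).1 u

/-- Composed with `τ`, the line integral is the partial integral in the `i`-th variable of `g ∘ T`,
where `T` has column `e` and complementary block `τ`. Plain Fubini would not suffice: the lines are
oblique and `τ` is arbitrary. -/
theorem IsGLFubini.lineIntegral {n : ℕ} {g : (Fin (n + 1) → k) → ℂ} (hg : IsGLFubini μ g)
    {i : Fin (n + 1)} {e : Fin (n + 1) → k} (he : e i ≠ 0) :
    IsGLFubini μ (lineIntegral μ g i e) := by
  intro τ
  obtain ⟨T, hT⟩ := exists_GL_insertNth i e he τ
  simpa [hT, FubiniLift.lineIntegral] using ((hg T).2 i).2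

variable [LocallyCompactSpace k] [μ.IsAddHaarMeasure]

theorem measurePreserving_insertNth {n : ℕ} (i : Fin (n + 1)) :
    MeasurePreserving (MeasurableEquiv.piFinSuccAbove (fun _ => k) i).symm
      (μ.prod (Measure.pi fun _ : Fin n => μ)) (Measure.pi fun _ : Fin (n + 1) => μ) := by
  -- Properness makes `k` σ-compact and second countable, so `μ` is σ-finite, as product measures
  -- require.
  have : ProperSpace k := .of_nontriviallyNormedField_of_weaklyLocallyCompactSpace k
  exact (measurePreserving_piFinSuccAbove (fun _ => μ) i).symm

theorem integrable_insertNth {n : ℕ} {g : (Fin (n + 1) → k) → ℂ}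
    (hg : Integrable g (Measure.pi fun _ => μ)) (i : Fin (n + 1)) :
    Integrable (fun p : k × (Fin n → k) => g (i.insertNth (α := fun _ => k) p.1 p.2))
      (μ.prod (Measure.pi fun _ => μ)) :=
  ((measurePreserving_insertNth μ i).integrable_comp_emb
    (MeasurableEquiv.measurableEmbedding _)).2 hg

theorem integral_pi_eq_integral_insertNth {n : ℕ} {g : (Fin (n + 1) → k) → ℂ}
    (hg : Integrable g (Measure.pi fun _ => μ)) (i : Fin (n + 1)) :
    ∫ v, g v ∂(Measure.pi fun _ => μ) =
      ∫ w, ∫ u, g (i.insertNth (α := fun _ => k) w u) ∂(Measure.pi fun _ => μ) ∂μ := by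
  have : ProperSpace k := .of_nontriviallyNormedField_of_weaklyLocallyCompactSpace k
  rw [← (measurePreserving_insertNth μ i).integral_comp (MeasurableEquiv.measurableEmbedding _)]
  exact integral_prod _ (integrable_insertNth μ hg i)

variable [BorelSpace k]

/-- After exchanging the integrals, the components of `w • e` off `i` only translate `u`, which Haar
measure ignores; what remains is the scaling `w ↦ z w` of the `i`-th coordinate. -/
theorem integral_lineIntegral {n : ℕ} {g : (Fin (n + 1) → k) → ℂ} (hg : IsGLFubini μ g)
    {i : Fin (n + 1)} {e : Fin (n + 1) → k} (z : kˣ) (he : e i = z) :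
    ∫ u, lineIntegral μ g i e u ∂(Measure.pi fun _ => μ) =
      invModulus z * ∫ v, g v ∂(Measure.pi fun _ => μ) := by
  have : ProperSpace k := .of_nontriviallyNormedField_of_weaklyLocallyCompactSpace k
  obtain ⟨T, hT⟩ := exists_GL_insertNth i e (he ▸ z.ne_zero) 1
  have hint : Integrable (fun p : k × (Fin n → k) =>
      g (i.insertNth (α := fun _ => k) 0 p.2 + p.1 • e)) (μ.prod (Measure.pi fun _ => μ)) := by
    simpa [hT] using integrable_insertNth μ (hg T).1 i
  have hshear : ∀ (w : k) (u : Fin n → k), i.insertNth (α := fun _ => k) 0 u + w • e =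
      i.insertNth (α := fun _ => k) (z * w) (u + w • fun j => e (i.succAbove j)) := by
    intro w u
    ext a
    rcases Fin.eq_self_or_eq_succAbove i a with rfl | ⟨a, rfl⟩
    · simp [he, mul_comm]
    · simp
  calc ∫ u, lineIntegral μ g i e u ∂(Measure.pi fun _ => μ)
      = ∫ w, ∫ u, g (i.insertNth (α := fun _ => k) 0 u + w • e) ∂(Measure.pi fun _ => μ) ∂μ :=
        (integral_integral_swap hint).symm
    _ = ∫ w, ∫ u, g (i.insertNth (α := fun _ => k) (z * w) u) ∂(Measure.pi fun _ => μ) ∂μ := by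
        refine integral_congr_ae (.of_forall fun w => ?_)
        simp only [hshear]
        exact integral_add_right_eq_self
          (fun u => g (i.insertNth (α := fun _ => k) (z * w) u)) _
    _ = invModulus z *
          ∫ w, ∫ u, g (i.insertNth (α := fun _ => k) w u) ∂(Measure.pi fun _ => μ) ∂μ :=
        integral_mul_left_eq_invModulus μ z
          (fun w => ∫ u, g (i.insertNth (α := fun _ => k) w u) ∂(Measure.pi fun _ => μ))
    _ = _ := by rw [← integral_pi_eq_integral_insertNth μ (hg.isResidueFubini).1 i]

end Residue

/-! ### Residues and pullbacks of functions from `k^n` to `F^n`. -/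

section Reduction

variable {Γ F k : Type*} [AddCommGroup Γ] [LinearOrder Γ] [IsOrderedAddMonoid Γ] [Field F]
  [Field k] (S : SplitValuation Γ F k)

namespace SplitValuation

open Classical in
/-- The residue map, extended by zero to the whole field. -/
def res (x : F) : k := if h : x ∈ S.integers then S.residue ⟨x, h⟩ else 0

theorem res_of_mem {x : F} (h : x ∈ S.integers) : S.res x = S.residue ⟨x, h⟩ := dif_pos h

theorem res_zero : S.res 0 = 0 := by
  rw [S.res_of_mem S.integers.zero_mem]; exact map_zero S.residue

theorem res_one : S.res 1 = 1 := by
  rw [S.res_of_mem S.integers.one_mem]; exact map_one S.residue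

theorem res_add {x y : F} (hx : x ∈ S.integers) (hy : y ∈ S.integers) :
    S.res (x + y) = S.res x + S.res y := by
  rw [S.res_of_mem hx, S.res_of_mem hy, S.res_of_mem (S.integers.add_mem hx hy), ← map_add]
  rfl

theorem res_mul {x y : F} (hx : x ∈ S.integers) (hy : y ∈ S.integers) :
    S.res (x * y) = S.res x * S.res y := by
  rw [S.res_of_mem hx, S.res_of_mem hy, S.res_of_mem (S.integers.mul_mem hx hy), ← map_mul]
  rfl

theorem mem_integers_of_v_eq_zero {x : F} (hx : S.v x = 0) : x ∈ S.integers :=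
  (S.mem_integers_iff x).2 hx.ge

theorem res_ne_zero {x : F} (hx : S.v x = 0) : S.res x ≠ 0 := by
  rw [S.res_of_mem (S.mem_integers_of_v_eq_zero hx)]
  intro h
  exact ((S.residue_eq_zero_iff _).1 h).ne' hx

theorem v_mul_tt_neg {x : F} {ρ : Γ} (hx : S.v x = ρ) : S.v (x * S.tt (-ρ)) = 0 := by
  rw [AddValuation.map_mul, hx, v_tt, ← WithTop.coe_add, add_neg_cancel, WithTop.coe_zero]

theorem mul_tt_neg_mem {x : F} {ρ : Γ} (hx : (ρ : WithTop Γ) ≤ S.v x) :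
    x * S.tt (-ρ) ∈ S.integers := by
  rw [mem_integers_iff, AddValuation.map_mul, v_tt, ← WithTop.coe_zero, ← add_neg_cancel ρ,
    WithTop.coe_add]
  exact add_le_add_left hx _

theorem tt_mul_tt_neg (ρ : Γ) : S.tt ρ * S.tt (-ρ) = 1 := by
  rw [← tt_add, add_neg_cancel, tt_zero]

theorem mem_of_mul_mem {x y : F} (hy : S.v y = 0) (h : x * y ∈ S.integers) : x ∈ S.integers := by
  rwa [mem_integers_iff, AddValuation.map_mul, hy, add_zero] at h

open Classical in
theorem lift_eq_ite {A : Type*} [AddCommGroup A] (g : k → A) (a : F) (γ : Γ) (x : F) :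
    S.lift g a γ x =
      if (x - a) * S.tt (-γ) ∈ S.integers then g (S.res ((x - a) * S.tt (-γ))) else 0 := by
  split_ifs with h
  · rw [S.lift_of_mem _ _ _ _ h, S.res_of_mem h]
  · rw [S.lift_of_notMem _ _ _ _ h]

open Classical in
/-- The extension by zero to `F^n` of the pullback of a function on `k^n` along the reduction
of integral vectors. -/
def pullback {A : Type*} [AddCommGroup A] {n : ℕ} (g : (Fin n → k) → A) (y : Fin n → F) : A :=
  if ∀ i, y i ∈ S.integers then g (fun i => S.res (y i)) else 0

theorem liftPi_eq_pullback {A : Type*} [AddCommGroup A] {n : ℕ} (g : (Fin n → k) → A)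
    (a : Fin n → F) (γ : Fin n → Γ) (x : Fin n → F) :
    S.liftPi g a γ x = S.pullback g fun i => (x i - a i) * S.tt (-γ i) := by
  unfold liftPi pullback
  split_ifs with h
  · congr 1
    funext i
    rw [S.res_of_mem (h i)]
  · rfl

open Classical in
/-- On a line, the pullback of a function on `k^n` is a lift of a function on `k`. -/
theorem pullback_line {A : Type*} [AddCommGroup A] {n : ℕ} (g : (Fin n → k) → A)
    (c d : Fin n → F) (i : Fin n) (ρ : Γ) (hρ : S.v (d i) = ρ)
    (hmin : ∀ j, (ρ : WithTop Γ) ≤ S.v (d j)) (s : F) :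
    S.pullback g (c + s • d) =
      S.lift (fun w => if ∀ j, c j - d j / d i * c i ∈ S.integers then
          g ((fun j => S.res (c j - d j / d i * c i)) + w • fun j => S.res (d j * S.tt (-ρ)))
        else 0) (-(c i / d i)) (-ρ) s := by
  have hdi : d i ≠ 0 := fun h => by simp [h] at hρ
  have hd : ∀ j, d j * S.tt (-ρ) ∈ S.integers := fun j => S.mul_tt_neg_mem (hmin j)
  have hdi0 := S.v_mul_tt_neg hρ
  -- The line is based anew at its point with `i`-th coordinate zero, and its parameter is rescaled
  -- so that the direction is `d` divided by `t(ρ)`.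
  have hy : ∀ j, (c + s • d) j = (c j - d j / d i * c i) +
      ((s - -(c i / d i)) * S.tt (- -ρ)) * (d j * S.tt (-ρ)) := by
    intro j
    have h1 := S.tt_mul_tt_neg ρ
    rw [neg_neg, show (s - -(c i / d i)) * S.tt ρ * (d j * S.tt (-ρ)) =
      (s + c i / d i) * d j * (S.tt ρ * S.tt (-ρ)) by ring, h1]
    simp only [Pi.add_apply, Pi.smul_apply, smul_eq_mul]
    field_simp
    ring
  set q := (s - -(c i / d i)) * S.tt (- -ρ) with hq
  have hci : c i - d i / d i * c i = 0 := by field_simp; ring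
  -- The `i`-th coordinate is `q` times a unit, so integrality of the point forces that of `q`, and
  -- then that of the new base point.
  have hqmem : (∀ j, (c + s • d) j ∈ S.integers) → q ∈ S.integers := by
    intro h
    have := h i
    rw [hy i, hci, zero_add] at this
    exact S.mem_of_mul_mem hdi0 this
  rw [S.lift_eq_ite, ← hq]
  unfold pullback
  by_cases hc : ∀ j, c j - d j / d i * c i ∈ S.integers
  · by_cases hqm : q ∈ S.integers
    · have hall : ∀ j, (c + s • d) j ∈ S.integers := fun j => by
        rw [hy j]; exact S.integers.add_mem (hc j) (S.integers.mul_mem hqm (hd j))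
      rw [if_pos hall, if_pos hqm, if_pos hc]
      congr 1
      funext j
      rw [hy j, S.res_add (hc j) (S.integers.mul_mem hqm (hd j)), S.res_mul hqm (hd j)]
      rfl
    · rw [if_neg hqm, if_neg fun h => hqm (hqmem h)]
  · have hnall : ¬ ∀ j, (c + s • d) j ∈ S.integers := by
      refine fun h => hc fun j => ?_
      rw [eq_sub_of_add_eq (hy j).symm]
      exact S.integers.sub_mem (h j) (S.integers.mul_mem (hqmem h) (hd j))
    rw [if_neg hnall, if_neg hc, ite_self]

/-- Every column of an invertible matrix has an entry of least valuation, which is nonzero. -/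
theorem exists_pivot {n : ℕ} (A : Matrix (Fin (n + 1)) (Fin (n + 1)) F) (hA : A.det ≠ 0)
    (r : Fin (n + 1)) :
    ∃ (i : Fin (n + 1)) (ρ : Γ), S.v (A i r) = ρ ∧ ∀ j, (ρ : WithTop Γ) ≤ S.v (A j r) := by
  obtain ⟨i, hi⟩ := Finite.exists_min fun j => S.v (A j r)
  have hne : S.v (A i r) ≠ ⊤ := by
    intro htop
    refine hA (Matrix.det_eq_zero_of_column_eq_zero r fun j => ?_)
    have := hi j
    rw [htop, top_le_iff] at this
    exact (AddValuation.top_iff _).1 this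
  obtain ⟨ρ, hρ⟩ := WithTop.ne_top_iff_exists.1 hne
  exact ⟨i, ρ, hρ.symm, fun j => hρ ▸ hi j⟩

theorem exists_v_eq_coe {x : F} (hx : x ≠ 0) : ∃ ρ : Γ, S.v x = ρ := by
  obtain ⟨ρ, hρ⟩ := WithTop.ne_top_iff_exists.1 ((AddValuation.ne_top_iff S.v).2 hx)
  exact ⟨ρ, hρ.symm⟩

theorem v_neg_one_pow (m : ℕ) : S.v ((-1 : F) ^ m) = 0 := by
  rcases neg_one_pow_eq_or F m with h | h <;> simp [h]

theorem res_neg_one_pow (m : ℕ) : S.res ((-1 : F) ^ m) = (-1) ^ m := by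
  have h : S.res (-1 : F) = -1 := by
    have := S.res_add S.integers.one_mem (S.integers.neg_mem S.integers.one_mem)
    rw [add_neg_cancel, S.res_zero, S.res_one] at this
    exact (neg_eq_of_add_eq_zero_right this.symm).symm
  induction m with
  | zero => simp [S.res_one]
  | succ m ih =>
    rw [pow_succ, pow_succ, S.res_mul (S.mem_integers_of_v_eq_zero (S.v_neg_one_pow m))
      (S.integers.neg_mem S.integers.one_mem), ih, h]

theorem tt_sum {ι : Type*} (s : Finset ι) (γ : ι → Γ) :
    S.tt (∑ i ∈ s, γ i) = ∏ i ∈ s, S.tt (γ i) := by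
  classical
  induction s using Finset.induction_on with
  | empty => simp [S.tt_zero]
  | insert i s hi ih => rw [Finset.sum_insert hi, Finset.prod_insert hi, S.tt_add, ih]

end SplitValuation

end Reduction

theorem X_add {Γ : Type*} [AddCommGroup Γ] [LinearOrder Γ] [IsOrderedAddMonoid Γ] (γ δ : Γ) :
    X (γ + δ) = X γ * X δ := by
  simp [X, ← map_mul, AddMonoidAlgebra.single_mul_single]

/-! ### Elimination of one variable by a Schur complement. -/

section Schur

variable {F : Type*} [Field F] {n : ℕ}

/-- The Schur complement of the entry `(i, r)` of a matrix. -/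
def schurComplement (A : Matrix (Fin (n + 1)) (Fin (n + 1)) F) (i r : Fin (n + 1)) :
    Matrix (Fin n) (Fin n) F :=
  Matrix.of fun a b => A (i.succAbove a) (r.succAbove b) -
    A (i.succAbove a) r / A i r * A i (r.succAbove b)

/-- Subtracting multiples of the pivot row clears the rest of column `r` without changing the
determinant; then expand along that column. -/
theorem det_eq_mul_det_schurComplement (A : Matrix (Fin (n + 1)) (Fin (n + 1)) F)
    (i r : Fin (n + 1)) (h : A i r ≠ 0) :
    A.det = (-1) ^ (i + r : ℕ) * A i r * (schurComplement A i r).det := by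
  let B : Matrix (Fin (n + 1)) (Fin (n + 1)) F :=
    fun a b => A a b - (if a = i then 0 else A a r / A i r) * A i b
  have hAB : A.det = B.det :=
    Matrix.det_eq_of_forall_row_eq_smul_add_const (fun a => if a = i then 0 else A a r / A i r) i
      (by simp) (fun a b => by simp [B])
  have hB : B.submatrix i.succAbove r.succAbove = schurComplement A i r := by
    ext a b
    rw [Matrix.submatrix_apply]
    simp [B, schurComplement]
  rw [hAB, Matrix.det_succ_column B r, Fin.sum_univ_succAbove _ i, hB,
    Finset.sum_eq_zero fun a _ => by simp [B, h], add_zero]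
  simp [B]

theorem mulVec_insertNth (A : Matrix (Fin (n + 1)) (Fin (n + 1)) F) (r : Fin (n + 1)) (y : F)
    (x : Fin n → F) : A.mulVec (r.insertNth (α := fun _ => F) y x) =
      (A.submatrix id r.succAbove).mulVec x + y • fun j => A j r := by
  ext a
  simp [Matrix.mulVec, dotProduct, Fin.sum_univ_succAbove _ r]
  ring

/-- The left side is a coordinate of the new base point in `pullback_line`; its affine dependence on
the remaining variables is what keeps the induction within affine pullbacks. -/
theorem schurComplement_mulVec (A : Matrix (Fin (n + 1)) (Fin (n + 1)) F) (i r : Fin (n + 1))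
    (b : Fin (n + 1) → F) (x : Fin n → F) (a : Fin n) :
    ((A.submatrix id r.succAbove).mulVec x + b) (i.succAbove a) -
        A (i.succAbove a) r / A i r * ((A.submatrix id r.succAbove).mulVec x + b) i =
      ((schurComplement A i r).mulVec x +
        fun a => b (i.succAbove a) - A (i.succAbove a) r / A i r * b i) a := by
  simp only [schurComplement, Matrix.mulVec, dotProduct, Pi.add_apply, Matrix.submatrix_apply,
    id, Matrix.of_apply, sub_mul, Finset.sum_sub_distrib, mul_add, Finset.mul_sum, mul_assoc]
  ring

end Schur

/-! ### Sections and partial integrals of affine pullbacks. -/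

section AffinePullback

variable {Γ F k : Type*} [AddCommGroup Γ] [LinearOrder Γ] [IsOrderedAddMonoid Γ] [Field F]
  [NontriviallyNormedField k] [MeasurableSpace k] (S : SplitValuation Γ F k) (μ : Measure k)

namespace SplitValuation

/-- The pullback of `g` along an affine map of `F^n`, times `X ^ δ`. -/
def affinePullback {n : ℕ} (g : (Fin n → k) → ℂ) (A : Matrix (Fin n) (Fin n) F) (b : Fin n → F)
    (δ : Γ) (x : Fin n → F) : CGamma Γ :=
  const Γ (S.pullback g (A.mulVec x + b)) * X δ

theorem IsSimple.mem_integrableFunctions {f : F → CGamma Γ} (hf : S.IsSimple μ f) :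
    f ∈ S.integrableFunctions μ := Submodule.subset_span hf

variable {n : ℕ} {g : (Fin (n + 1) → k) → ℂ} {A : Matrix (Fin (n + 1)) (Fin (n + 1)) F}
  {b : Fin (n + 1) → F} {δ : Γ} {i r : Fin (n + 1)} {ρ : Γ}

open Classical in
/-- A section of an affine pullback is a lift. -/
theorem affinePullback_section (hg : IsGLFubini μ g) (hρ : S.v (A i r) = ρ)
    (hmin : ∀ j, (ρ : WithTop Γ) ≤ S.v (A j r)) (x : Fin n → F) :
    ∃ φ : k → ℂ, Integrable φ μ ∧
      ∫ w, φ w ∂μ = S.pullback (lineIntegral μ g i fun j => S.res (A j r * S.tt (-ρ)))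
        ((schurComplement A i r).mulVec x +
          fun a => b (i.succAbove a) - A (i.succAbove a) r / A i r * b i) ∧
      ∃ a : F, (fun y => S.affinePullback g A b δ (r.insertNth (α := fun _ => F) y x)) =
        fun y => const Γ (S.lift φ a (-ρ) y) * X δ := by
  set e : Fin (n + 1) → k := fun j => S.res (A j r * S.tt (-ρ)) with he
  have hei : e i ≠ 0 := S.res_ne_zero (S.v_mul_tt_neg hρ)
  have hp : A i r ≠ 0 := fun h => by simp [h] at hρ
  set c : Fin (n + 1) → F := (A.submatrix id r.succAbove).mulVec x + b with hc
  set c' : Fin (n + 1) → F := fun j => c j - A j r / A i r * c i with hc'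
  have hc'i : c' i = 0 := by simp [hc', hp]
  have hc's : ∀ a, c' (i.succAbove a) = ((schurComplement A i r).mulVec x +
      fun a => b (i.succAbove a) - A (i.succAbove a) r / A i r * b i) a :=
    fun a => schurComplement_mulVec A i r b x a
  have hres : (fun j => S.res (c' j)) = i.insertNth (α := fun _ => k) 0
      (fun a => S.res (c' (i.succAbove a))) := by
    ext j
    rcases Fin.eq_self_or_eq_succAbove i j with rfl | ⟨j, rfl⟩
    · simp [hc'i, S.res_zero]
    · simp
  -- As `c' i = 0`, the integrality condition passes to the remaining coordinates unchanged, where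
  -- it is the support condition of the new pullback.
  have hall : (∀ j, c' j ∈ S.integers) ↔ ∀ a, c' (i.succAbove a) ∈ S.integers := by
    rw [Fin.forall_iff_succAbove i, hc'i]
    exact and_iff_right S.integers.zero_mem
  refine ⟨fun w => if ∀ j, c' j ∈ S.integers then g ((fun j => S.res (c' j)) + w • e) else 0,
    ?_, ?_, -(c i / A i r), ?_⟩
  · split_ifs
    · rw [hres]
      exact hg.integrable_line μ hei _
    · exact integrable_zero _ _ _
  · unfold pullback
    simp only [← hc's, ← hall]
    split_ifs
    · rw [hres]
      rfl
    · simp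
  · funext y
    have harg : A.mulVec (r.insertNth (α := fun _ => F) y x) + b = c + y • fun j => A j r := by
      rw [mulVec_insertNth, hc]; abel
    rw [affinePullback, harg, S.pullback_line g c (fun j => A j r) i ρ hρ hmin y]

theorem isSimple_affinePullback_section (hg : IsGLFubini μ g) (hA : A.det ≠ 0)
    (r : Fin (n + 1)) (x : Fin n → F) :
    S.IsSimple μ fun y => S.affinePullback g A b δ (r.insertNth (α := fun _ => F) y x) := by
  obtain ⟨i, ρ, hρ, hmin⟩ := S.exists_pivot A hA r
  obtain ⟨φ, hφ, -, a, h⟩ := S.affinePullback_section (b := b) (δ := δ) μ hg hρ hmin x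
  exact ⟨φ, hφ, a, -ρ, δ, h⟩

variable [LocallyCompactSpace k] [BorelSpace k] [μ.IsAddHaarMeasure]

theorem integral_lift_mul_X {φ : k → ℂ} (hφ : Integrable φ μ) (a : F) (γ δ : Γ) :
    S.integral μ (fun x => const Γ (S.lift φ a γ x) * X δ) =
      const Γ (∫ u, φ u ∂μ) * X (δ + γ) := by
  refine S.integral_eq_of_mem μ ?_
  have := (S.integralGraph μ).smul_mem (X δ) (Submodule.subset_span ⟨φ, hφ, a, γ, rfl⟩)
  convert this using 1
  ext
  · simp [mul_comm]
  · simp only [Prod.smul_mk, smul_eq_mul, X_add]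
    ring

/-- Integrating out a variable, one obtains another affine pullback. -/
theorem partialIntegral_affinePullback (hg : IsGLFubini μ g) (hρ : S.v (A i r) = ρ)
    (hmin : ∀ j, (ρ : WithTop Γ) ≤ S.v (A j r)) :
    S.partialIntegral μ r (S.affinePullback g A b δ) =
      S.affinePullback (lineIntegral μ g i fun j => S.res (A j r * S.tt (-ρ)))
        (schurComplement A i r)
        (fun a => b (i.succAbove a) - A (i.succAbove a) r / A i r * b i) (δ - ρ) := by
  funext x
  obtain ⟨φ, hφ, hint, a, h⟩ := S.affinePullback_section (b := b) (δ := δ) μ hg hρ hmin x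
  rw [partialIntegral, h, S.integral_lift_mul_X μ hφ, hint, affinePullback, sub_eq_add_neg]

end SplitValuation

end AffinePullback

/-! ### Change of variables by induction on the dimension. -/

section ChangeOfVariables

variable {Γ F k : Type*} [AddCommGroup Γ] [LinearOrder Γ] [IsOrderedAddMonoid Γ] [Field F]
  [NontriviallyNormedField k] [LocallyCompactSpace k] [MeasurableSpace k] [BorelSpace k]
  (S : SplitValuation Γ F k) (μ : Measure k) [μ.IsAddHaarMeasure]

namespace SplitValuation

/-- Affine pullbacks of GL-Fubini functions along invertible affine maps are strongly Fubini, and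
the repeated integral is computed by the change of variables formula. -/
theorem affinePullback_stronglyFubini (n : ℕ) (g : (Fin n → k) → ℂ) (hg : IsGLFubini μ g)
    (A : Matrix (Fin n) (Fin n) F) (b : Fin n → F) (δ ρ : Γ) (hρ : S.v A.det = ρ) (z : kˣ)
    (hz : S.res (A.det * S.tt (-ρ)) = z) :
    S.IsFubini μ n (S.affinePullback g A b δ) ∧
    S.IsStronglyFubini μ n (S.affinePullback g A b δ) ∧
    S.repeatedIntegral μ n (S.affinePullback g A b δ) =
      const Γ (invModulus z * ∫ u, g u ∂(Measure.pi fun _ => μ)) * X (δ - ρ) := by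
  induction n generalizing δ ρ z with
  | zero =>
    refine ⟨trivial, trivial, ?_⟩
    have hdet : A.det = 1 := Matrix.det_isEmpty
    have h0 : ρ = 0 := by
      rw [hdet, AddValuation.map_one] at hρ
      exact_mod_cast hρ.symm
    have hz1 : z = 1 := by
      rw [hdet, h0, neg_zero, S.tt_zero, mul_one, S.res_one] at hz
      exact Units.ext hz.symm
    have hpb : ∀ y, S.pullback g y = g default := fun y => by
      rw [pullback, if_pos fun i => i.elim0]
      exact congrArg g (Subsingleton.elim _ _)
    have : ProperSpace k := .of_nontriviallyNormedField_of_weaklyLocallyCompactSpace k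
    rw [Measure.pi_of_empty (fun _ : Fin 0 => μ) default, integral_dirac]
    simp [repeatedIntegral, affinePullback, hpb, hz1, invModulus_one, h0]
  | succ n ih =>
    have hA : A.det ≠ 0 := fun h => by simp [h] at hρ
    -- The value asserted does not involve `r`; this gives the independence of order in `IsFubini`.
    have step : ∀ r : Fin (n + 1),
        S.IsFubini μ n (S.partialIntegral μ r (S.affinePullback g A b δ)) ∧
        S.IsStronglyFubini μ n (S.partialIntegral μ r (S.affinePullback g A b δ)) ∧
        S.repeatedIntegral μ n (S.partialIntegral μ r (S.affinePullback g A b δ)) =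
          const Γ (invModulus z * ∫ u, g u ∂(Measure.pi fun _ => μ)) * X (δ - ρ) := by
      intro r
      obtain ⟨i, σ, hσ, hmin⟩ := S.exists_pivot A hA r
      rw [S.partialIntegral_affinePullback μ hg hσ hmin]
      have hp : A i r ≠ 0 := fun h => by simp [h] at hσ
      have hei := S.res_ne_zero (S.v_mul_tt_neg hσ)
      have hdet := det_eq_mul_det_schurComplement A i r hp
      have hS0 : (schurComplement A i r).det ≠ 0 := fun h => hA (by rw [hdet, h, mul_zero])
      obtain ⟨τ, hτ⟩ := S.exists_v_eq_coe hS0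
      have hsum : ρ = σ + τ := by
        rw [hdet, AddValuation.map_mul, AddValuation.map_mul, S.v_neg_one_pow, hσ, hτ,
          zero_add] at hρ
        exact_mod_cast hρ.symm
      obtain ⟨hF, hSF, hR⟩ := ih _ (hg.lineIntegral μ (e := fun j => S.res (A j r * S.tt (-σ))) hei) (schurComplement A i r)
        (fun a => b (i.succAbove a) - A (i.succAbove a) r / A i r * b i) (δ - σ) τ hτ
        (Units.mk0 _ (S.res_ne_zero (S.v_mul_tt_neg hτ))) rfl
      refine ⟨hF, hSF, hR.trans ?_⟩
      -- The leading residue of `det A` is a sign times those of the pivot and of the Schur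
      -- complement. The pivot contributes through the line integral, the Schur complement through
      -- the induction hypothesis.
      have hzz : z = (-1) ^ (i + r : ℕ) * Units.mk0 _ hei *
          Units.mk0 _ (S.res_ne_zero (S.v_mul_tt_neg hτ)) := by
        have hm1 := S.mem_integers_of_v_eq_zero (S.v_neg_one_pow (i + r : ℕ))
        have hm2 := S.mem_integers_of_v_eq_zero (S.v_mul_tt_neg hσ)
        have hm3 := S.mem_integers_of_v_eq_zero (S.v_mul_tt_neg hτ)
        have hfac : A.det * S.tt (-ρ) = (-1) ^ (i + r : ℕ) * (A i r * S.tt (-σ)) *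
            ((schurComplement A i r).det * S.tt (-τ)) := by
          rw [hdet, hsum, neg_add, S.tt_add]; ring
        ext
        rw [← hz, hfac, S.res_mul (S.integers.mul_mem hm1 hm2) hm3, S.res_mul hm1 hm2,
          S.res_neg_one_pow]
        simp
      rw [integral_lineIntegral μ hg (Units.mk0 _ hei) rfl, hzz, invModulus_mul, invModulus_mul,
        invModulus_neg_one_pow, hsum, sub_sub]
      congr 2
      ring
    have hsimple := fun r x =>
      S.isSimple_affinePullback_section (b := b) (δ := δ) μ hg hA r x
    have hF : S.IsFubini μ (n + 1) (S.affinePullback g A b δ) :=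
      ⟨fun r => ⟨fun x => IsSimple.mem_integrableFunctions S μ (hsimple r x), (step r).1⟩,
        fun r s => (step r).2.2.trans (step s).2.2.symm⟩
    -- `repeatedIntegral` integrates out the variable of index `0` first, hence `step 0`.
    exact ⟨hF, ⟨hF, fun r => ⟨hsimple r, (step r).2.1⟩⟩, (step 0).2.2⟩

/-- The change of variables formula for a lift and a unipotent upper triangular matrix. -/
theorem liftPi_comp_unipotent {n : ℕ} (g : (Fin n → k) → ℂ) (hg : IsGLFubini μ g)
    (a : Fin n → F) (γ : Fin n → Γ) (δ : Γ) (U : Matrix (Fin n) (Fin n) F)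
    (hU : IsUnipotentUpperTriangular U) :
    S.IsStronglyFubini μ n (fun x => const Γ (S.liftPi g a γ (U.mulVec x)) * X δ) ∧
    S.repeatedIntegral μ n (fun x => const Γ (S.liftPi g a γ (U.mulVec x)) * X δ) =
      const Γ (∫ u, g u ∂(Measure.pi fun _ => μ)) * X (δ + ∑ i, γ i) := by
  let D : Matrix (Fin n) (Fin n) F := Matrix.diagonal fun i => S.tt (-γ i)
  have hf : (fun x => const Γ (S.liftPi g a γ (U.mulVec x)) * X δ) =
      S.affinePullback g (D * U) (-D.mulVec a) δ := by
    funext x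
    rw [affinePullback, S.liftPi_eq_pullback, ← Matrix.mulVec_mulVec]
    congr 3
    funext i
    simp [D, Matrix.mulVec_diagonal, -Matrix.mulVec_mulVec]
    ring
  have hdet : (D * U).det = S.tt (-∑ i, γ i) := by
    have hU1 : U.det = 1 := by
      rw [Matrix.det_of_isUpperTriangular fun i j h => hU.1 i j h]
      simp [hU.2]
    rw [Matrix.det_mul, hU1, mul_one, Matrix.det_diagonal, ← Finset.sum_neg_distrib, S.tt_sum]
  -- The determinant is exactly `t(-∑ γ i)`, so its leading residue is `1` and no modulus appears.
  obtain ⟨-, h1, h2⟩ := S.affinePullback_stronglyFubini μ n g hg (D * U) (-D.mulVec a) δ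
    (-∑ i, γ i) (by rw [hdet, S.v_tt]) 1 (by rw [hdet, S.tt_mul_tt_neg, S.res_one]; rfl)
  rw [hf]
  exact ⟨h1, by rw [h2, invModulus_one, one_mul, sub_neg_eq_add]⟩

end SplitValuation

end ChangeOfVariables

end FubiniLift

end

theorem mainTheorem5 {Γ F k : Type*} [AddCommGroup Γ] [LinearOrder Γ] [IsOrderedAddMonoid Γ]
    [Field F] [NontriviallyNormedField k] [LocallyCompactSpace k]
    [MeasurableSpace k] [BorelSpace k] (μ : MeasureTheory.Measure k) [μ.IsAddHaarMeasure]
    (S : FubiniLift.SplitValuation Γ F k)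
    (n : ℕ) (g : (Fin n → k) → ℂ) (hg : FubiniLift.IsGLFubini μ g)
    (a : Fin n → F) (γ : Fin n → Γ) (δ : Γ)
    (f : (Fin n → F) → FubiniLift.CGamma Γ)
    (hf : f = fun x => FubiniLift.const Γ (S.liftPi g a γ x) * FubiniLift.X δ)
    (U : Matrix (Fin n) (Fin n) F) (hU : FubiniLift.IsUnipotentUpperTriangular U) :
    S.IsStronglyFubini μ n (fun x => f (U.mulVec x)) ∧
      S.repeatedIntegral μ n (fun x => f (U.mulVec x)) = S.repeatedIntegral μ n f := by
  subst hf
  obtain ⟨h1, h2⟩ := S.liftPi_comp_unipotent μ g hg a γ δ U hU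
  -- The same formula with the identity matrix computes the integral of `f` itself.
  have h3 := (S.liftPi_comp_unipotent μ g hg a γ δ 1
    ⟨fun i j h => Matrix.one_apply_ne h.ne', Matrix.one_apply_eq⟩).2
  simp only [Matrix.one_mulVec] at h3
  exact ⟨h1, h2.trans h3.symm⟩
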